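/- **Trees.** Trees are built from the constants $S,K$, the symbols $\mathcal C$ and $R_0,R_1,R_2,\dots$, and binary application (associating to the left). Throughout, $X$ stands for $S$ or $K$; a tree $X\alpha_1\cdots\alpha_m$ with $m\ge 1$ is called complex. The symbol $\mathcal C$ has the productions $\mathcal C\to S\mid K\mid \mathcal C\,\mathcal C$; the productions of $R_n$ form the set, also denoted $R_n$, defined below by recursion on $n$. **Rewriting.** $\alpha\trianglerighteq\beta$ means that $\beta$ is obtained from $\alpha$ by finitely many (possibly zero) steps, each replacing one occurrence of a symbol $\mathcal C$ or $R_k$ by the right-hand side of one of its productions, or one occurrence of $\mathcal C$ by some $R_k$. **Mesh sets.** For arguments $\alpha,\beta$ let $\mathrm{Mesh}(\alpha,\beta)$ be $\{\beta\}$ if $\alpha\trianglerighteq\beta$; otherwise $\{\alpha\}$ if $\beta\trianglerighteq\alpha$; otherwise $\mathrm{MeshSet}(\alpha,\beta)$. Here - $\mathrm{MeshSet}(X\alpha_1\cdots\alpha_m,\,X\beta_1\cdots\beta_m)=\{X\gamma_1\cdots\gamma_m : \gamma_i\in\mathrm{Mesh}(\alpha_i,\beta_i)\text{ for all }i\}$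 for $m\ge1$; - $\mathrm{MeshSet}(R_k,\beta)=\bigcup_{\delta\in R_k}\mathrm{MeshSet}(\delta,\beta)$ and $\mathrm{MeshSet}(\beta,R_k)=\bigcup_{\delta\in R_k}\mathrm{MeshSet}(\beta,\delta)$ for complex $\beta$; - $\mathrm{MeshSet}(\alpha,\beta)=\emptyset$ in all other cases. **Rewriting sets.** - $\mathrm{RewritingSet}(\alpha,S)=\mathrm{RewritingSet}(\alpha,K)=\emptyset$ and $\mathrm{RewritingSet}(\alpha,\mathcal C)=\{\mathcal C\,\alpha\}$; - $\mathrm{RewritingSet}(\alpha,R_k)=\bigcup_{\gamma\in R_k}\mathrm{RewritingSet}(\alpha,\gamma)$; - $\mathrm{RewritingSet}(\alpha,X\beta_1\cdots\beta_m)=\{X\beta_1\cdots\beta_{m-1}\gamma : \gamma\in\mathrm{Mesh}(\alpha,\beta_m)\}$ for $m\ge1$. **Expansions.** For $\alpha=X\alpha_1\cdots\alpha_m$ let $$\mathrm{KExp}(\alpha)=\{K(X\alpha_1\cdots\alpha_k)\,\mathcal C\,\alpha_{k+1}\cdots\alpha_m : 0\le k\le m-1\},$$ $$\mathrm{SExp}(\alpha)=\{S(X\alpha_1\cdots\alpha_k)\,\varphi_l\,\varphi_r\,\alpha_{k+3}\cdots\alpha_m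 : 0\le k\le m-2,\ \varphi_l\varphi_r\in\mathrm{RewritingSet}(\alpha_{k+1},\alpha_{k+2})\}.$$ **Normal-order reduction grammars.** $R_0=\{S,\ K,\ S R_0,\ K R_0,\ S R_0 R_0\}$ and, for $n\ge1$, $$R_n=\{S R_n,\ K R_n\}\cup\{S R_{n-i}R_i : 0\le i\le n\}\cup\{K R_{n-1}\mathcal C\}\cup\bigcup_{\alpha\in R_{n-1}}\mathrm{KExp}(\alpha)\cup\bigcup_{\alpha\in R_{n-1}}\mathrm{SExp}(\alpha).$$ **Theorem.** Let $\psi,\chi:\mathbb N\to\mathbb N$ be given by $\psi(0)=1$, $\chi(0)=5$ and, for $k\ge1$, $$\psi(k)=4\,(\psi(k-1)+2)!+2\psi(k-1)+5,$$ $$\chi(k)=4+k+2k\,\chi(k-1)+(2k-1)\,\chi(k-1)^{\,2+3(\psi(k-1)+3)!}.$$ Then $\chi$ is primitive recursive and, for every $n\in\mathbb N$, the set $R_n$ is finite and its number of productions satisfies $|R_n|\le\chi(n)$. In particular, there exists a primitive recursive function bounding the number of productions of $R_n$. -/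

import Mathlib

namespace ReductionGrammar

/-- The primitive combinators. -/
inductive Comb : Type
  | S : Comb
  | K : Comb

/-- Trees over the terminals `S`, `K`, binary application, and the non-terminals `C`
(all combinatory logic terms) and `R k` (the axiom of the `k`-th reduction grammar). -/
inductive Tree : Type
  | comb : Comb → Tree
  | C : Tree
  | R : ℕ → Tree
  | app : Tree → Tree → Tree

/-- `h a₁ … aₘ`, with application associating to the left. -/
def apps (h : Tree) (as : List Tree) : Tree := as.foldl Tree.app h

/-- `X a₁ … aₘ` for a primitive combinator `X`. -/
def cx (X : Comb) (as : List Tree) : Tree := apps (Tree.comb X) as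

/-- `α` is complex: `α = X a₁ … aₘ` with `m ≥ 1`. -/
def IsComplex (α : Tree) : Prop := ∃ (X : Comb) (as : List Tree), as ≠ [] ∧ α = cx X as

/-- One rewriting step, where `P k` is the set of productions of the non-terminal `R k`:
a derivation step (of `C ::= S | K | C C`, or of some `R k`) or a step from `C` to some `R k`,
applied at an arbitrary position. -/
inductive Step (P : ℕ → Set Tree) : Tree → Tree → Prop
  | c_comb (X : Comb) : Step P Tree.C (Tree.comb X)
  | c_app : Step P Tree.C (Tree.app Tree.C Tree.C)
  | c_ref (k : ℕ) : Step P Tree.C (Tree.R k)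
  | prod (k : ℕ) (γ : Tree) : γ ∈ P k → Step P (Tree.R k) γ
  | app_left (α α' β : Tree) : Step P α α' → Step P (Tree.app α β) (Tree.app α' β)
  | app_right (α β β' : Tree) : Step P β β' → Step P (Tree.app α β) (Tree.app α β')

/-- `α` rewrites to `β` (`α ⊵ β`): the reflexive transitive closure of `Step`. -/
def Rew (P : ℕ → Set Tree) : Tree → Tree → Prop := Relation.ReflTransGen (Step P)

mutual

/-- `IsArgMesh P α β γ`: `γ` belongs to the set of meshes of two corresponding arguments `α`, `β`.
That set is `{β}` if `α ⊵ β`, otherwise `{α}` if `β ⊵ α`, otherwise the mesh set of `α` and `β`. -/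
inductive IsArgMesh (P : ℕ → Set Tree) : Tree → Tree → Tree → Prop
  | left (α β : Tree) : Rew P α β → IsArgMesh P α β β
  | right (α β : Tree) : ¬ Rew P α β → Rew P β α → IsArgMesh P α β α
  | mesh (α β γ : Tree) : ¬ Rew P α β → ¬ Rew P β α → IsMesh P α β γ → IsArgMesh P α β γ

/-- `IsMesh P α β γ`: `γ` belongs to the mesh set of `α` and `β`. -/
inductive IsMesh (P : ℕ → Set Tree) : Tree → Tree → Tree → Prop
  | similar (X : Comb) (m : ℕ) (a b c : Fin (m + 1) → Tree) :
      (∀ i, IsArgMesh P (a i) (b i) (c i)) →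
      IsMesh P (cx X (List.ofFn a)) (cx X (List.ofFn b)) (cx X (List.ofFn c))
  | ref_left (k : ℕ) (δ β γ : Tree) : IsComplex β → δ ∈ P k → IsMesh P δ β γ →
      IsMesh P (Tree.R k) β γ
  | ref_right (k : ℕ) (δ α γ : Tree) : IsComplex α → δ ∈ P k → IsMesh P α δ γ →
      IsMesh P α (Tree.R k) γ

end

/-- `IsRewriting P α β φ`: `φ` belongs to the rewriting set of `α` and `β`. In the constructor
`complex`, `b` is the last argument of `β = X b₁ … bₘ₋₁ b`. -/
inductive IsRewriting (P : ℕ → Set Tree) : Tree → Tree → Tree → Prop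
  | c (α : Tree) : IsRewriting P α Tree.C (Tree.app Tree.C α)
  | ref (α : Tree) (k : ℕ) (γ φ : Tree) : γ ∈ P k → IsRewriting P α γ φ →
      IsRewriting P α (Tree.R k) φ
  | complex (α : Tree) (X : Comb) (bs : List Tree) (b c : Tree) : IsArgMesh P α b c →
      IsRewriting P α (Tree.app (cx X bs) b) (Tree.app (cx X bs) c)

/-- The K-expansions `K (X a₁ … aₖ) C aₖ₊₁ … aₘ`, `0 ≤ k ≤ m - 1`, of `α = X a₁ … aₘ`. -/
def kExpansions (α : Tree) : Set Tree :=
  {τ | ∃ (X : Comb) (as bs : List Tree), bs ≠ [] ∧ α = cx X (as ++ bs) ∧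
    τ = cx Comb.K (cx X as :: Tree.C :: bs)}

/-- The S-expansions `S (X a₁ … aₖ) φₗ φᵣ aₖ₊₃ … aₘ`, `0 ≤ k ≤ m - 2`, of `α = X a₁ … aₘ`, where
`φₗ φᵣ` belongs to the rewriting set of `aₖ₊₁` and `aₖ₊₂`. -/
def sExpansions (P : ℕ → Set Tree) (α : Tree) : Set Tree :=
  {τ | ∃ (X : Comb) (as : List Tree) (x y : Tree) (bs : List Tree) (φl φr : Tree),
    α = cx X (as ++ x :: y :: bs) ∧ IsRewriting P x y (Tree.app φl φr) ∧
    τ = cx Comb.S (cx X as :: φl :: φr :: bs)}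

/-- The productions of `R_{n+1}`, given the productions `P k` of `R_k` for `k ≤ n`. -/
def nextGrammar (n : ℕ) (P : ℕ → Set Tree) : Set Tree :=
  {cx Comb.S [Tree.R (n + 1)], cx Comb.K [Tree.R (n + 1)]}
    ∪ {τ | ∃ i j : ℕ, i + j = n + 1 ∧ τ = cx Comb.S [Tree.R i, Tree.R j]}
    ∪ {cx Comb.K [Tree.R n, Tree.C]}
    ∪ (⋃ α ∈ P n, kExpansions α)
    ∪ (⋃ α ∈ P n, sExpansions P α)

/-- The set of productions of the `n`-th normal-order reduction grammar `R_n`. -/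
def grammar : ℕ → Set Tree
  | 0 => {Tree.comb Comb.S, Tree.comb Comb.K, cx Comb.S [Tree.R 0], cx Comb.K [Tree.R 0],
      cx Comb.S [Tree.R 0, Tree.R 0]}
  | n + 1 => nextGrammar n (fun k => if _h : k ≤ n then grammar k else ∅)
  termination_by n => n
  decreasing_by omega

/-- The function `ψ`, with `ψ(0) = 1` and `ψ(k) = 4 (ψ(k-1) + 2)! + 2 ψ(k-1) + 5` for `k ≥ 1`. -/
def psi : ℕ → ℕ
  | 0 => 1
  | k + 1 => 4 * (psi k + 2).factorial + 2 * psi k + 5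

/-- The function `χ`, with `χ(0) = 5` and
`χ(k) = 4 + k + 2k χ(k-1) + (2k - 1) χ(k-1) ^ (2 + 3 (ψ(k-1) + 3)!)` for `k ≥ 1`. -/
def chi : ℕ → ℕ
  | 0 => 5
  | k + 1 => 4 + (k + 1) + 2 * (k + 1) * chi k
      + (2 * k + 1) * chi k ^ (2 + 3 * (psi k + 3).factorial)

end ReductionGrammar

namespace ReductionGrammar

/-! ### Monotonicity and growth of `psi` and `chi` -/

-- The proof rests on a weight: `S`, `K` and `C` weigh 1, `R k` weighs `psi k`, and application adds
-- weights. Suppose every `P k` has at most `N` productions, whose arguments weigh at most `psi k`.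
-- Then two trees of weights `a` and `b` have at most `N ^ (a * b)` meshes, each of weight at most
-- `a * b` (`meshBound`). The induction is on `a + b`. Unfolding `R k` may yield a heavier tree, but
-- its arguments are no heavier than `R k`, while those of the complex tree on the other side are
-- strictly lighter than that tree.
--
-- Rewriting sets inherit such bounds (`rewriting_bound`), and these control both the number and the
-- weight of S-expansions. So the bounds on the productions of `R n` pass to `R (n + 1)`
-- (`controlled_nextGrammar`): `psi` grows fast enough to absorb the new weights, and `chi` to
-- absorb the new count. The factorials in both are far larger than this argument needs; quadratic
-- growth of `psi` and the exponent `2 + psi n * psi n` in `chi` would do.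

lemma one_le_psi : ∀ k, 1 ≤ psi k
  | 0 => le_rfl
  | k + 1 => by simp only [psi]; omega

lemma psi_mono : Monotone psi :=
  monotone_nat_of_le_succ fun k => by simp only [psi]; omega

lemma mul_le_factorial_add_two (a : ℕ) : (a + 2) * (a + 1) ≤ (a + 2).factorial := by
  rw [Nat.factorial_succ, Nat.factorial_succ]
  exact Nat.mul_le_mul_left _ (Nat.le_mul_of_pos_right _ a.factorial_pos)

/-- The quadratic covers the weight of an S-expansion: a rewriting contributes at most `psi k * (1 +
2 * psi k)`, and the rest is linear in `psi k`. -/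
lemma psi_succ_ge (k : ℕ) : 2 * psi k * psi k + 3 * psi k + 3 ≤ psi (k + 1) := by
  have := mul_le_factorial_add_two (psi k)
  simp only [psi]
  nlinarith

/-- Two arguments of weight at most `psi k` give the mesh exponent `psi k * psi k`, which must fit
under the exponent in `chi`. -/
lemma psi_sq_le (k : ℕ) : psi k * psi k ≤ 3 * (psi k + 3).factorial := by
  have := mul_le_factorial_add_two (psi k + 1)
  nlinarith

lemma chi_mono : Monotone chi := by
  refine monotone_nat_of_le_succ fun k => ?_
  have : 1 * chi k ≤ 2 * (k + 1) * chi k := Nat.mul_le_mul_right _ (by omega)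
  simp only [chi]
  omega

lemma one_le_chi (k : ℕ) : 1 ≤ chi k :=
  le_trans (by simp [chi]) (chi_mono (Nat.zero_le k))

/-! ### Primitive recursiveness of `chi` -/

lemma primrec_factorial : Primrec Nat.factorial := by
  refine (Primrec.nat_rec₁ (f := fun n ih => (n + 1) * ih) 1
    (Primrec.nat_mul.comp₂ (Primrec.succ.comp₂ Primrec₂.left) Primrec₂.right)).of_eq fun n => ?_
  induction n with
  | zero => rfl
  | succ n ih => simp only [Nat.factorial_succ, ← ih]

lemma primrec_pow : Primrec₂ (fun a b : ℕ => a ^ b) :=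
  Primrec₂.unpaired'.1 Nat.Primrec.pow

lemma primrec_psi : Primrec psi := by
  have hf : Primrec₂ fun (_ ih : ℕ) => 4 * (ih + 2).factorial + 2 * ih + 5 := by
    have h : Primrec fun x : ℕ => 4 * (x + 2).factorial + 2 * x + 5 :=
      Primrec.nat_add.comp (Primrec.nat_add.comp
        (Primrec.nat_mul.comp (Primrec.const 4)
          (primrec_factorial.comp (Primrec.nat_add.comp Primrec.id (Primrec.const 2))))
        (Primrec.nat_mul.comp (Primrec.const 2) Primrec.id)) (Primrec.const 5)
    exact h.comp₂ Primrec₂.right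
  refine (Primrec.nat_rec₁ 1 hf).of_eq fun n => ?_
  induction n with
  | zero => rfl
  | succ n ih => simp only [psi, ← ih]

lemma primrec_chi : Primrec chi := by
  have hf : Primrec₂ fun (k ih : ℕ) => 4 + (k + 1) + 2 * (k + 1) * ih
      + (2 * k + 1) * ih ^ (2 + 3 * (psi k + 3).factorial) := by
    have hk : Primrec fun p : ℕ × ℕ => p.1 := Primrec.fst
    have hi : Primrec fun p : ℕ × ℕ => p.2 := Primrec.snd
    have hk1 : Primrec fun p : ℕ × ℕ => p.1 + 1 := Primrec.succ.comp hk
    have h2k : Primrec fun p : ℕ × ℕ => 2 * (p.1 + 1) :=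
      Primrec.nat_mul.comp (Primrec.const 2) hk1
    have h2k1 : Primrec fun p : ℕ × ℕ => 2 * p.1 + 1 :=
      Primrec.succ.comp (Primrec.nat_mul.comp (Primrec.const 2) hk)
    have he : Primrec fun p : ℕ × ℕ => 2 + 3 * (psi p.1 + 3).factorial :=
      Primrec.nat_add.comp (Primrec.const 2) (Primrec.nat_mul.comp (Primrec.const 3)
        (primrec_factorial.comp (Primrec.nat_add.comp (primrec_psi.comp hk) (Primrec.const 3))))
    exact Primrec.nat_add.comp (Primrec.nat_add.comp
      (Primrec.nat_add.comp (Primrec.const 4) hk1) (Primrec.nat_mul.comp h2k hi))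
      (Primrec.nat_mul.comp h2k1 (primrec_pow.comp hi he))
  refine (Primrec.nat_rec₁ 5 hf).of_eq fun n => ?_
  induction n with
  | zero => rfl
  | succ n ih => simp only [chi, ← ih]

/-! ### Complex trees -/

/-- The arguments of `h a₁ … aₘ`. -/
def args : Tree → List Tree
  | Tree.app f x => args f ++ [x]
  | _ => []

/-- The head of `h a₁ … aₘ`. -/
def head : Tree → Tree
  | Tree.app f _ => head f
  | t => t

lemma cx_concat (X : Comb) (as : List Tree) (a : Tree) :
    cx X (as ++ [a]) = Tree.app (cx X as) a := by
  simp [cx, apps]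

lemma args_cx (X : Comb) (as : List Tree) : args (cx X as) = as := by
  induction as using List.reverseRecOn with
  | nil => rfl
  | append_singleton as a ih => rw [cx_concat, args, ih]

lemma head_cx (X : Comb) (as : List Tree) : head (cx X as) = Tree.comb X := by
  induction as using List.reverseRecOn with
  | nil => rfl
  | append_singleton as a ih => rw [cx_concat, head, ih]

lemma cx_inj {X Y : Comb} {as bs : List Tree} (h : cx X as = cx Y bs) : X = Y ∧ as = bs := by
  constructor
  · have := congrArg head h
    rwa [head_cx, head_cx, Tree.comb.injEq] at this
  · have := congrArg args h
    rwa [args_cx, args_cx] at this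

lemma cx_ne_R (X : Comb) (as : List Tree) (k : ℕ) : cx X as ≠ Tree.R k := fun h => by
  have := congrArg head h
  rw [head_cx] at this
  cases this

lemma cx_ne_C (X : Comb) (as : List Tree) : cx X as ≠ Tree.C := fun h => by
  have := congrArg head h
  rw [head_cx] at this
  cases this

/-! ### Weights -/

/-- The weight of a tree, where `R k` weighs `psi k`. -/
def weight : Tree → ℕ
  | Tree.comb _ => 1
  | Tree.C => 1
  | Tree.R k => psi k
  | Tree.app a b => weight a + weight b

lemma one_le_weight : ∀ a, 1 ≤ weight a
  | Tree.comb _ => le_rfl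
  | Tree.C => le_rfl
  | Tree.R k => one_le_psi k
  | Tree.app a b => by
    have := one_le_weight a
    simp only [weight]; omega

lemma weight_cx (X : Comb) (as : List Tree) : weight (cx X as) = 1 + (as.map weight).sum := by
  induction as using List.reverseRecOn with
  | nil => rfl
  | append_singleton as a ih => rw [cx_concat, weight, ih]; simp; omega

lemma weight_cx_ofFn (X : Comb) {m : ℕ} (a : Fin m → Tree) :
    weight (cx X (List.ofFn a)) = 1 + ∑ i, weight (a i) := by
  rw [weight_cx, List.map_ofFn, List.sum_ofFn]; rfl

lemma weight_lt_weight_cx (X : Comb) {as : List Tree} {a : Tree} (h : a ∈ as) :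
    weight a < weight (cx X as) := by
  have := List.single_le_sum (l := as.map weight) (by simp) _ (List.mem_map_of_mem h)
  rw [weight_cx]; omega

/-! ### Finite covers -/

/-- The set `s` is contained in a finite set of at most `c` elements. -/
def Covered (s : Set Tree) (c : ℕ) : Prop := ∃ F : Finset Tree, s ⊆ ↑F ∧ F.card ≤ c

namespace Covered

lemma mono {s t : Set Tree} {c d : ℕ} (h : Covered t d) (hs : s ⊆ t) (hc : d ≤ c) :
    Covered s c :=
  let ⟨F, hF, hd⟩ := h
  ⟨F, hs.trans hF, hd.trans hc⟩

lemma empty (c : ℕ) : Covered ∅ c := ⟨∅, by simp, by simp⟩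

lemma singleton (a : Tree) : Covered {a} 1 := ⟨{a}, by simp, by simp⟩

lemma finite {s : Set Tree} {c : ℕ} (h : Covered s c) : s.Finite :=
  let ⟨F, hF, _⟩ := h
  F.finite_toSet.subset hF

lemma ncard_le {s : Set Tree} {c : ℕ} (h : Covered s c) : s.ncard ≤ c := by
  obtain ⟨F, hF, hc⟩ := h
  exact (Set.ncard_le_ncard hF F.finite_toSet).trans ((Set.ncard_coe_finset F).trans_le hc)

lemma union {s t : Set Tree} {c d : ℕ} (hs : Covered s c) (ht : Covered t d) :
    Covered (s ∪ t) (c + d) := by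
  classical
  obtain ⟨F, hF, hc⟩ := hs
  obtain ⟨G, hG, hd⟩ := ht
  refine ⟨F ∪ G, ?_, (Finset.card_union_le F G).trans (add_le_add hc hd)⟩
  rw [Finset.coe_union]
  exact Set.union_subset_union hF hG

lemma biUnion_finset {ι : Type*} (F : Finset ι) {f : ι → Set Tree} {d : ℕ}
    (hf : ∀ a ∈ F, Covered (f a) d) : Covered (⋃ a ∈ F, f a) (F.card * d) := by
  classical
  choose! G hG hd using hf
  refine ⟨F.biUnion G, ?_, Finset.card_biUnion_le_card_mul _ _ _ hd⟩
  intro x hx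
  simp only [Set.mem_iUnion] at hx
  obtain ⟨a, ha, hx⟩ := hx
  exact Finset.mem_biUnion.2 ⟨a, ha, hG a ha hx⟩

lemma biUnion {s : Set Tree} {f : Tree → Set Tree} {c d : ℕ} (hs : Covered s c)
    (hf : ∀ a ∈ s, Covered (f a) d) : Covered (⋃ a ∈ s, f a) (c * d) := by
  classical
  obtain ⟨F, hF, hc⟩ := hs
  refine (biUnion_finset (F.filter (· ∈ s)) (f := f) (d := d)
    fun a ha => hf a (Finset.mem_filter.1 ha).2).mono ?_
    (Nat.mul_le_mul_right _ ((Finset.card_filter_le _ _).trans hc))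
  intro x hx
  simp only [Set.mem_iUnion] at hx ⊢
  obtain ⟨a, ha, hx⟩ := hx
  exact ⟨a, Finset.mem_filter.2 ⟨hF ha, ha⟩, hx⟩

lemma image {s : Set Tree} {c : ℕ} (hs : Covered s c) (g : Tree → Tree) : Covered (g '' s) c := by
  classical
  obtain ⟨F, hF, hc⟩ := hs
  refine ⟨F.image g, ?_, Finset.card_image_le.trans hc⟩
  rw [Finset.coe_image]
  exact Set.image_mono hF

lemma pi {m : ℕ} {s : Fin m → Set Tree} {c : Fin m → ℕ} (hs : ∀ i, Covered (s i) (c i))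
    (g : (Fin m → Tree) → Tree) : Covered {γ | ∃ x, (∀ i, x i ∈ s i) ∧ γ = g x} (∏ i, c i) := by
  classical
  choose F hF hc using hs
  refine ⟨(Fintype.piFinset F).image g, ?_, Finset.card_image_le.trans ?_⟩
  · rintro _ ⟨x, hx, rfl⟩
    exact Finset.mem_coe.2 (Finset.mem_image_of_mem g (Fintype.mem_piFinset.2 fun i => hF i (hx i)))
  · rw [Fintype.card_piFinset]
    exact Finset.prod_le_prod' fun i _ => hc i

end Covered

/-! ### Counting meshes and rewritings -/

/-- Every `P k` has at most `N` elements, all of the form `X a₁ … aₘ` with arguments of weight at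
most `psi k` and of total weight at most `1 + 2 * psi k`. -/
structure Admissible (P : ℕ → Set Tree) (N : ℕ) : Prop where
  one_le : 1 ≤ N
  covered : ∀ k, Covered (P k) N
  shape : ∀ k, ∀ δ ∈ P k, ∃ X as, δ = cx X as ∧ ∀ a ∈ as, weight a ≤ psi k
  weight_le : ∀ k, ∀ δ ∈ P k, weight δ ≤ 1 + 2 * psi k

/-- The meshes of the arguments `α`, `β` are bounded in number and in weight. -/
def ArgBound (P : ℕ → Set Tree) (N : ℕ) (α β : Tree) : Prop :=
  Covered {γ | IsArgMesh P α β γ} (N ^ (weight α * weight β)) ∧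
    ∀ γ, IsArgMesh P α β γ → weight γ ≤ weight α * weight β

/-- The mesh set of `α` and `β` is bounded in number and in weight. -/
def MeshBound (P : ℕ → Set Tree) (N : ℕ) (α β : Tree) : Prop :=
  Covered {γ | IsMesh P α β γ} (N ^ (weight α * weight β)) ∧
    ∀ γ, IsMesh P α β γ → weight γ ≤ weight α * weight β

variable {P : ℕ → Set Tree} {N : ℕ}

/-- If one argument rewrites to the other, the mesh is unique and is one of the two; its weight is
at most the product because weights are positive. -/
lemma MeshBound.argBound (hN : 1 ≤ N) {α β : Tree} (h : MeshBound P N α β) :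
    ArgBound P N α β := by
  have hα := one_le_weight α
  have hβ := one_le_weight β
  by_cases h1 : Rew P α β
  · have key : ∀ γ, IsArgMesh P α β γ → γ = β := by
      intro γ hγ
      cases hγ <;> first | rfl | contradiction
    refine ⟨(Covered.singleton β).mono key (Nat.one_le_pow _ _ hN), fun γ hγ => ?_⟩
    rw [key γ hγ]
    exact Nat.le_mul_of_pos_left _ hα
  by_cases h2 : Rew P β α
  · have key : ∀ γ, IsArgMesh P α β γ → γ = α := by
      intro γ hγ
      cases hγ <;> first | rfl | contradiction
    refine ⟨(Covered.singleton α).mono key (Nat.one_le_pow _ _ hN), fun γ hγ => ?_⟩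
    rw [key γ hγ]
    exact Nat.le_mul_of_pos_right _ hβ
  have key : ∀ γ, IsArgMesh P α β γ → IsMesh P α β γ := by
    intro γ hγ
    cases hγ <;> first | assumption | contradiction
  exact ⟨h.1.mono key le_rfl, fun γ hγ => h.2 γ (key γ hγ)⟩

/-- At least one side is always complex: two symbols `R j`, `R k` have no meshes. This is what makes
the weight induction descend. -/
lemma IsMesh.cases_shape {α β γ : Tree} (h : IsMesh P α β γ) :
    (IsComplex α ∧ IsComplex β) ∨ (IsComplex β ∧ ∃ k, α = Tree.R k) ∨
      (IsComplex α ∧ ∃ k, β = Tree.R k) := by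
  cases h with
  | similar X m a b c h =>
    exact .inl ⟨⟨X, _, by simp, rfl⟩, ⟨X, _, by simp, rfl⟩⟩
  | ref_left k δ β γ h1 h2 h3 => exact .inr (.inl ⟨h1, k, rfl⟩)
  | ref_right k δ β γ h1 h2 h3 => exact .inr (.inr ⟨h1, k, rfl⟩)

lemma IsMesh.cx_inv {X Y : Comb} {as bs : List Tree} {α β γ : Tree} (h : IsMesh P α β γ)
    (hα : α = cx X as) (hβ : β = cx Y bs) :
    ∃ (m : ℕ) (a b c : Fin m → Tree), as = List.ofFn a ∧ bs = List.ofFn b ∧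
      (∀ i, IsArgMesh P (a i) (b i) (c i)) ∧ γ = cx X (List.ofFn c) := by
  cases h with
  | similar Z m a b c h =>
    obtain ⟨rfl, rfl⟩ := cx_inj hα
    obtain ⟨rfl, rfl⟩ := cx_inj hβ
    exact ⟨_, a, b, c, rfl, rfl, h, rfl⟩
  | ref_left k => exact absurd hα.symm (cx_ne_R _ _ _)
  | ref_right k => exact absurd hβ.symm (cx_ne_R _ _ _)

lemma not_isComplex_R (k : ℕ) : ¬ IsComplex (Tree.R k) := fun ⟨_, _, _, h⟩ =>
  cx_ne_R _ _ _ h.symm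

lemma IsMesh.ref_left_inv {k : ℕ} {β γ : Tree} (h : IsMesh P (Tree.R k) β γ) :
    ∃ δ ∈ P k, IsMesh P δ β γ := by
  generalize hα : Tree.R k = α at h
  cases h with
  | similar Z m a b c h => exact absurd hα.symm (cx_ne_R _ _ _)
  | ref_left k δ β γ h1 h2 h3 =>
    cases hα
    exact ⟨δ, h2, h3⟩
  | ref_right k δ β γ h1 h2 h3 => exact absurd (hα ▸ h1) (not_isComplex_R _)

lemma IsMesh.ref_right_inv {k : ℕ} {α γ : Tree} (h : IsMesh P α (Tree.R k) γ) :
    ∃ δ ∈ P k, IsMesh P α δ γ := by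
  generalize hβ : Tree.R k = β at h
  cases h with
  | similar Z m a b c h => exact absurd hβ.symm (cx_ne_R _ _ _)
  | ref_left k δ β γ h1 h2 h3 => exact absurd (hβ ▸ h1) (not_isComplex_R _)
  | ref_right k δ β γ h1 h2 h3 =>
    cases hβ
    exact ⟨δ, h2, h3⟩

/-- Meshes of complex trees are chosen argument by argument, so the counts multiply and the
exponents add up to `e = ∑ i, weight (a i) * weight (b i)`. The heads leave a surplus of 1 in the
exponent, which later pays for the choice of a production. The bound `B` stands for `psi k` when one
side is a production of `R k`, whose own weight may exceed that of `R k`. -/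
lemma mesh_cx_bound {X Y : Comb} {as bs : List Tree}
    (h : ∀ a ∈ as, ∀ b ∈ bs, ArgBound P N a b) :
    ∃ e, Covered {γ | IsMesh P (cx X as) (cx Y bs) γ} (N ^ e) ∧
      (∀ γ, IsMesh P (cx X as) (cx Y bs) γ → weight γ ≤ e + 1) ∧
      (∀ B, 1 ≤ B → (∀ a ∈ as, weight a ≤ B) → e + 1 ≤ B * weight (cx Y bs)) ∧
      (∀ B, 1 ≤ B → (∀ b ∈ bs, weight b ≤ B) → e + 1 ≤ weight (cx X as) * B) := by
  by_cases hne : ∃ γ, IsMesh P (cx X as) (cx Y bs) γ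
  swap
  · refine ⟨0, (Covered.empty _).mono (fun γ hγ => hne ⟨γ, hγ⟩) le_rfl,
      fun γ hγ => absurd ⟨γ, hγ⟩ hne, fun B hB _ => ?_, fun B hB _ => ?_⟩
    · exact Nat.mul_pos hB (one_le_weight _)
    · exact Nat.mul_pos (one_le_weight _) hB
  obtain ⟨γ, hγ⟩ := hne
  -- A single mesh forces both argument lists to have a common length `m`; the case without meshes
  -- was settled by `e = 0`.
  obtain ⟨m, a, b, -, rfl, rfl, -, -⟩ := hγ.cx_inv rfl rfl
  have key : ∀ γ, IsMesh P (cx X (List.ofFn a)) (cx Y (List.ofFn b)) γ →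
      ∃ c : Fin m → Tree, (∀ i, IsArgMesh P (a i) (b i) (c i)) ∧ γ = cx X (List.ofFn c) := by
    intro γ hγ
    obtain ⟨m', a', b', c, ha, hb, hc, rfl⟩ := hγ.cx_inv rfl rfl
    obtain rfl : m = m' := by simpa using congrArg List.length ha
    obtain rfl := List.ofFn_injective ha
    obtain rfl := List.ofFn_injective hb
    exact ⟨c, hc, rfl⟩
  have h' : ∀ i, ArgBound P N (a i) (b i) := fun i => h _ (by simp) _ (by simp)
  refine ⟨∑ i, weight (a i) * weight (b i), ?_, ?_, ?_, ?_⟩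
  · rw [← Finset.prod_pow_eq_pow_sum]
    exact (Covered.pi (fun i => (h' i).1) fun c => cx X (List.ofFn c)).mono key le_rfl
  · intro γ hγ
    obtain ⟨c, hc, rfl⟩ := key γ hγ
    rw [weight_cx_ofFn, add_comm]
    exact Nat.add_le_add_right (Finset.sum_le_sum fun i _ => (h' i).2 _ (hc i)) 1
  · intro B hB hle
    rw [weight_cx_ofFn, mul_add, mul_one, add_comm, Finset.mul_sum]
    exact add_le_add hB (Finset.sum_le_sum fun i _ => Nat.mul_le_mul_right _ (hle _ (by simp)))
  · intro B hB hle
    rw [weight_cx_ofFn, add_mul, one_mul, add_comm, Finset.sum_mul]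
    exact add_le_add hB (Finset.sum_le_sum fun i _ => Nat.mul_le_mul_left _ (hle _ (by simp)))

/-- The induction passes from `R k` directly to the arguments of its productions, never through the
production itself, which can outweigh `R k`. -/
lemma meshBound (hP : Admissible P N) : ∀ s α β, weight α + weight β < s → MeshBound P N α β := by
  intro s
  induction s with
  | zero => intro α β h; omega
  | succ s ih =>
    have ih' : ∀ α β, weight α + weight β < s → ArgBound P N α β :=
      fun α β h => (ih α β h).argBound hP.one_le
    intro α β hs
    by_cases hne : ∃ γ, IsMesh P α β γ
    swap
    · exact ⟨(Covered.empty _).mono (fun γ hγ => hne ⟨γ, hγ⟩) le_rfl,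
        fun γ hγ => absurd ⟨γ, hγ⟩ hne⟩
    obtain ⟨γ, hγ⟩ := hne
    rcases hγ.cases_shape with ⟨⟨X, as, -, rfl⟩, ⟨Y, bs, -, rfl⟩⟩ | ⟨⟨Y, bs, -, rfl⟩, k, rfl⟩ |
      ⟨⟨X, as, -, rfl⟩, k, rfl⟩
    · obtain ⟨e, h1, h2, h3, -⟩ := mesh_cx_bound (X := X) (Y := Y) (as := as) (bs := bs)
        fun a ha b hb => ih' a b (by
          have := weight_lt_weight_cx X ha
          have := weight_lt_weight_cx Y hb
          omega)
      have he := h3 _ (one_le_weight (cx X as)) fun a ha => (weight_lt_weight_cx X ha).le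
      exact ⟨h1.mono subset_rfl (Nat.pow_le_pow_right hP.one_le (by omega)),
        fun γ hγ => (h2 γ hγ).trans he⟩
    · have key : ∀ δ ∈ P k, ∃ e, Covered {γ | IsMesh P δ (cx Y bs) γ} (N ^ e) ∧
          (∀ γ, IsMesh P δ (cx Y bs) γ → weight γ ≤ e + 1) ∧
          e + 1 ≤ weight (Tree.R k) * weight (cx Y bs) := by
        intro δ hδ
        obtain ⟨X, as, rfl, has⟩ := hP.shape k δ hδ
        obtain ⟨e, h1, h2, h3, -⟩ := mesh_cx_bound (X := X) (Y := Y) (as := as) (bs := bs)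
          fun a ha b hb => ih' a b (by
            have := has a ha
            have := weight_lt_weight_cx Y hb
            simp only [weight] at hs
            omega)
        exact ⟨e, h1, h2, h3 _ (one_le_psi k) has⟩
      constructor
      · have hpos := Nat.mul_pos (one_le_weight (Tree.R k)) (one_le_weight (cx Y bs))
        -- Each production uses an exponent at least one below the target, so the missing factor `N`
        -- pays for the union over `P k`.
        refine ((hP.covered k).biUnion (f := fun δ => {γ | IsMesh P δ (cx Y bs) γ})
          (d := N ^ (weight (Tree.R k) * weight (cx Y bs) - 1)) fun δ hδ => ?_).mono
          (fun γ hγ => ?_) ?_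
        · obtain ⟨e, h1, -, h3⟩ := key δ hδ
          exact h1.mono subset_rfl (Nat.pow_le_pow_right hP.one_le (by omega))
        · obtain ⟨δ, hδ, h⟩ := IsMesh.ref_left_inv hγ
          exact Set.mem_biUnion hδ h
        · rw [← pow_succ', Nat.sub_add_cancel hpos]
      · intro γ hγ
        obtain ⟨δ, hδ, h⟩ := hγ.ref_left_inv
        obtain ⟨e, -, h2, h3⟩ := key δ hδ
        exact (h2 γ h).trans h3
    · have key : ∀ δ ∈ P k, ∃ e, Covered {γ | IsMesh P (cx X as) δ γ} (N ^ e) ∧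
          (∀ γ, IsMesh P (cx X as) δ γ → weight γ ≤ e + 1) ∧
          e + 1 ≤ weight (cx X as) * weight (Tree.R k) := by
        intro δ hδ
        obtain ⟨Y, bs, rfl, hbs⟩ := hP.shape k δ hδ
        obtain ⟨e, h1, h2, -, h3⟩ := mesh_cx_bound (X := X) (Y := Y) (as := as) (bs := bs)
          fun a ha b hb => ih' a b (by
            have := hbs b hb
            have := weight_lt_weight_cx X ha
            simp only [weight] at hs
            omega)
        exact ⟨e, h1, h2, h3 _ (one_le_psi k) hbs⟩
      constructor
      · have hpos := Nat.mul_pos (one_le_weight (cx X as)) (one_le_weight (Tree.R k))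
        refine ((hP.covered k).biUnion (f := fun δ => {γ | IsMesh P (cx X as) δ γ})
          (d := N ^ (weight (cx X as) * weight (Tree.R k) - 1)) fun δ hδ => ?_).mono
          (fun γ hγ => ?_) ?_
        · obtain ⟨e, h1, -, h3⟩ := key δ hδ
          exact h1.mono subset_rfl (Nat.pow_le_pow_right hP.one_le (by omega))
        · obtain ⟨δ, hδ, h⟩ := IsMesh.ref_right_inv hγ
          exact Set.mem_biUnion hδ h
        · rw [← pow_succ', Nat.sub_add_cancel hpos]
      · intro γ hγ
        obtain ⟨δ, hδ, h⟩ := hγ.ref_right_inv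
        obtain ⟨e, -, h2, h3⟩ := key δ hδ
        exact (h2 γ h).trans h3

lemma argBound (hP : Admissible P N) (α β : Tree) : ArgBound P N α β :=
  (meshBound hP _ α β (Nat.lt_succ_self _)).argBound hP.one_le

lemma IsRewriting.cx_inv {α β φ : Tree} {Y : Comb} {bs : List Tree} (h : IsRewriting P α β φ)
    (hβ : β = cx Y bs) : ∃ cs b c, bs = cs ++ [b] ∧ IsArgMesh P α b c ∧
      φ = Tree.app (cx Y cs) c := by
  cases h with
  | c => exact absurd hβ.symm (cx_ne_C _ _)
  | ref k => exact absurd hβ.symm (cx_ne_R _ _ _)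
  | complex X cs b c h =>
    rw [← cx_concat] at hβ
    obtain ⟨rfl, rfl⟩ := cx_inj hβ
    exact ⟨cs, b, c, rfl, h, rfl⟩

lemma rewriting_cx_bound (hP : Admissible P N) (α : Tree) (Y : Comb) (bs : List Tree) {B : ℕ}
    (hB : ∀ b ∈ bs, weight b ≤ B) :
    Covered {φ | IsRewriting P α (cx Y bs) φ} (N ^ (weight α * B)) ∧
      ∀ φ, IsRewriting P α (cx Y bs) φ → weight φ ≤ weight α * weight (cx Y bs) := by
  constructor
  · rcases List.eq_nil_or_concat bs with rfl | ⟨cs, b, rfl⟩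
    · refine (Covered.empty _).mono (fun φ hφ => ?_) le_rfl
      obtain ⟨cs, b, c, h, -⟩ := IsRewriting.cx_inv hφ rfl
      simp at h
    · refine ((argBound hP α b).1.image (Tree.app (cx Y cs))).mono (fun φ hφ => ?_)
        (Nat.pow_le_pow_right hP.one_le (Nat.mul_le_mul_left _ (hB b (by simp))))
      obtain ⟨cs', b', c, h, hc, rfl⟩ := IsRewriting.cx_inv hφ rfl
      rw [List.concat_eq_append] at h
      obtain ⟨rfl, h⟩ := List.append_inj' h rfl
      obtain rfl : b = b' := by simpa using h
      exact ⟨c, hc, rfl⟩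
  · intro φ hφ
    obtain ⟨cs, b, c, rfl, hc, rfl⟩ := hφ.cx_inv rfl
    have := (argBound hP α b).2 c hc
    -- Only the last argument is meshed; the unchanged prefix is covered by its own weight times
    -- `weight α`.
    have := Nat.le_mul_of_pos_left (weight (cx Y cs)) (one_le_weight α)
    rw [cx_concat, weight, weight, mul_add]
    omega

/-- The extra 1 in the exponent and the factor `1 + 2 * weight β` both come from `β = R k`: a
production is chosen among at most `N`, and its total weight is at most `1 + 2 * psi k`. -/
lemma rewriting_bound (hP : Admissible P N) (α β : Tree) :
    Covered {φ | IsRewriting P α β φ} (N ^ (1 + weight α * weight β)) ∧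
      ∀ φ, IsRewriting P α β φ → weight φ ≤ weight α * (1 + 2 * weight β) := by
  have hα := one_le_weight α
  have hβ := one_le_weight β
  by_cases hne : ∃ φ, IsRewriting P α β φ
  swap
  · exact ⟨(Covered.empty _).mono (fun φ hφ => hne ⟨φ, hφ⟩) le_rfl,
      fun φ hφ => absurd ⟨φ, hφ⟩ hne⟩
  obtain ⟨φ, hφ⟩ := hne
  cases hφ with
  | c =>
    have key : ∀ φ, IsRewriting P α Tree.C φ → φ = Tree.app Tree.C α := by
      intro φ hφ
      generalize hβ : Tree.C = β at hφ
      cases hφ with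
      | c => rfl
      | ref => cases hβ
      | complex => cases hβ
    refine ⟨(Covered.singleton _).mono key (Nat.one_le_pow _ _ hP.one_le), fun φ hφ => ?_⟩
    rw [key φ hφ]
    simp only [weight]
    omega
  | ref k γ _ _ _ =>
    have key : ∀ φ, IsRewriting P α (Tree.R k) φ → ∃ γ ∈ P k, IsRewriting P α γ φ := by
      intro φ hφ
      generalize hβ : Tree.R k = β at hφ
      cases hφ with
      | c => cases hβ
      | ref j γ _ h1 h2 => cases hβ; exact ⟨γ, h1, h2⟩
      | complex => cases hβ
    constructor
    · refine ((hP.covered k).biUnion (f := fun γ => {φ | IsRewriting P α γ φ})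
        (d := N ^ (weight α * weight (Tree.R k))) fun γ hγ => ?_).mono
        (fun φ hφ => ?_) (by rw [pow_add, pow_one])
      · obtain ⟨Y, bs, rfl, hbs⟩ := hP.shape k γ hγ
        exact (rewriting_cx_bound hP α Y bs hbs).1
      · obtain ⟨γ, hγ, h⟩ := key φ hφ
        exact Set.mem_biUnion hγ h
    · intro φ hφ
      obtain ⟨γ, hγ, h⟩ := key φ hφ
      have hw := hP.weight_le k γ hγ
      obtain ⟨Y, bs, rfl, hbs⟩ := hP.shape k γ hγ
      exact ((rewriting_cx_bound hP α Y bs hbs).2 φ h).trans (Nat.mul_le_mul_left _ hw)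
  | complex X bs b c _ =>
    rw [← cx_concat]
    obtain ⟨h1, h2⟩ := rewriting_cx_bound hP α X (bs ++ [b]) fun a ha =>
      (weight_lt_weight_cx X ha).le
    exact ⟨h1.mono subset_rfl (Nat.pow_le_pow_right hP.one_le (by omega)),
      fun φ hφ => (h2 φ hφ).trans (Nat.mul_le_mul_left _ (by omega))⟩

/-! ### Counting productions -/

/-- The set `s` has at most `chi k` elements, all of the form `X a₁ … aₘ` with `m ≤ 2 * k + 2`,
arguments of weight at most `psi k` and total weight at most `1 + 2 * psi k`. -/
structure Controlled (k : ℕ) (s : Set Tree) : Prop where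
  covered : Covered s (chi k)
  shape : ∀ δ ∈ s, ∃ X as, δ = cx X as ∧ as.length ≤ 2 * k + 2 ∧ (∀ a ∈ as, weight a ≤ psi k) ∧
    weight δ ≤ 1 + 2 * psi k

/-- A K-expansion is determined by the position at which the argument list is cut. -/
lemma covered_kExpansions (X : Comb) (l : List Tree) :
    Covered (kExpansions (cx X l)) l.length := by
  refine (Covered.biUnion_finset (Finset.range l.length) (d := 1)
    (f := fun i => {cx Comb.K (cx X (l.take i) :: Tree.C :: l.drop i)})
    fun i _ => Covered.singleton _).mono ?_ (by simp)
  rintro τ ⟨Y, as, bs, hbs, h, rfl⟩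
  obtain ⟨rfl, rfl⟩ := cx_inj h
  have : 0 < bs.length := List.length_pos_iff.2 hbs
  refine Set.mem_biUnion (x := as.length) ?_ ?_
  · simpa using this
  · simp

lemma covered_sExpansions {P : ℕ → Set Tree} {N : ℕ} (hP : Admissible P N) (X : Comb)
    (l : List Tree) {B : ℕ} (hB : ∀ a ∈ l, weight a ≤ B) :
    Covered (sExpansions P (cx X l)) ((l.length - 1) * N ^ (1 + B * B)) := by
  -- An S-expansion is determined by its position and by the rewriting `φ`, split into its two
  -- halves. The value on trees that are not applications is never used.
  let split : Tree → Tree × Tree := fun φ => match φ with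
    | Tree.app a b => (a, b)
    | t => (t, t)
  refine (Covered.biUnion_finset (Finset.range (l.length - 1))
    (f := fun i => {τ | ∃ (as : List Tree) (x y : Tree) (bs : List Tree) (φl φr : Tree),
      as.length = i ∧ l = as ++ x :: y :: bs ∧ IsRewriting P x y (Tree.app φl φr) ∧
      τ = cx Comb.S (cx X as :: φl :: φr :: bs)})
    (d := N ^ (1 + B * B)) fun i _ => ?_).mono ?_ (by simp)
  · by_cases hi : ∃ (as : List Tree) (x y : Tree) (bs : List Tree),
      as.length = i ∧ l = as ++ x :: y :: bs
    swap
    · refine (Covered.empty _).mono ?_ le_rfl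
      rintro τ ⟨as, x, y, bs, _, _, h1, h2, -⟩
      exact hi ⟨as, x, y, bs, h1, h2⟩
    obtain ⟨as, x, y, bs, rfl, rfl⟩ := hi
    refine ((rewriting_bound hP x y).1.image
      fun φ => cx Comb.S (cx X as :: (split φ).1 :: (split φ).2 :: bs)).mono ?_
      (Nat.pow_le_pow_right hP.one_le (Nat.add_le_add_left
        (Nat.mul_le_mul (hB x (by simp)) (hB y (by simp))) 1))
    rintro τ ⟨as', x', y', bs', φl, φr, h1, h2, h3, rfl⟩
    obtain ⟨rfl, h4⟩ := List.append_inj h2 h1.symm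
    injection h4 with hx h4
    injection h4 with hy hb
    subst hx hy hb
    exact ⟨_, h3, rfl⟩
  · rintro τ ⟨Y, as, x, y, bs, φl, φr, h, hr, rfl⟩
    obtain ⟨rfl, rfl⟩ := cx_inj h
    exact Set.mem_iUnion₂.2 ⟨as.length, by simp,
      as, x, y, bs, φl, φr, rfl, rfl, hr, rfl⟩

/-- An expansion lengthens an argument list by at most two, whence the length bound `2 * k + 2`. A
production with at most `2 * n + 2` arguments has at most that many K-expansions and at most `2 * n
+ 1` positions for an S-expansion. -/
lemma controlled_nextGrammar {n : ℕ} {P : ℕ → Set Tree} (hP : Admissible P (chi n))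
    (hn : Controlled n (P n)) : Controlled (n + 1) (nextGrammar n P) := by
  have hψ := psi_succ_ge n
  have hψ1 := one_le_psi n
  -- Both kinds of expansion, and `K (R n) C`, have total weight at most `psi (n + 1)`, which bounds
  -- their arguments as well. Productions that may contain `R (n + 1)` can exceed this and are
  -- checked directly.
  have small : ∀ X as, as.length ≤ 2 * (n + 1) + 2 → weight (cx X as) ≤ psi (n + 1) →
      ∃ Y bs, cx X as = cx Y bs ∧ bs.length ≤ 2 * (n + 1) + 2 ∧
        (∀ a ∈ bs, weight a ≤ psi (n + 1)) ∧ weight (cx X as) ≤ 1 + 2 * psi (n + 1) :=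
    fun X as h1 h2 => ⟨X, as, rfl, h1, fun a ha => (weight_lt_weight_cx X ha).le.trans h2,
      by omega⟩
  constructor
  · have hpair : Covered {τ | ∃ i j : ℕ, i + j = n + 1 ∧ τ = cx Comb.S [Tree.R i, Tree.R j]}
        (n + 2) := by
      refine (Covered.biUnion_finset (Finset.HasAntidiagonal.antidiagonal (n + 1)) (d := 1)
        (f := fun p => {cx Comb.S [Tree.R p.1, Tree.R p.2]})
        fun i _ => Covered.singleton _).mono ?_ (by simp)
      rintro τ ⟨i, j, h, rfl⟩
      exact Set.mem_biUnion (x := (i, j)) (by simpa using h) rfl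
    have hK : Covered (⋃ α ∈ P n, kExpansions α) (chi n * (2 * n + 2)) :=
      hn.covered.biUnion fun α hα => by
        obtain ⟨X, as, rfl, hl, -⟩ := hn.shape α hα
        exact (covered_kExpansions X as).mono subset_rfl hl
    have hS : Covered (⋃ α ∈ P n, sExpansions P α)
        (chi n * ((2 * n + 1) * chi n ^ (1 + psi n * psi n))) :=
      hn.covered.biUnion fun α hα => by
        obtain ⟨X, as, rfl, hl, hw, -⟩ := hn.shape α hα
        exact (covered_sExpansions hP X as hw).mono subset_rfl
          (Nat.mul_le_mul_right _ (by omega))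
    have hpow : chi n ^ (2 + psi n * psi n) ≤ chi n ^ (2 + 3 * (psi n + 3).factorial) :=
      Nat.pow_le_pow_right (one_le_chi n) (Nat.add_le_add_left (psi_sq_le n) 2)
    refine ((((((Covered.singleton (cx Comb.S [Tree.R (n + 1)])).union
      (Covered.singleton (cx Comb.K [Tree.R (n + 1)]))).union hpair).union
      (Covered.singleton (cx Comb.K [Tree.R n, Tree.C]))).union hK).union hS).mono subset_rfl ?_
    calc 1 + 1 + (n + 2) + 1 + chi n * (2 * n + 2)
          + chi n * ((2 * n + 1) * chi n ^ (1 + psi n * psi n))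
        = 4 + (n + 1) + 2 * (n + 1) * chi n
          + (2 * n + 1) * chi n ^ (2 + psi n * psi n) := by ring
      _ ≤ chi (n + 1) := by
        simp only [chi]
        exact Nat.add_le_add_left (Nat.mul_le_mul_left _ hpow) _
  · rintro δ (((((hδ | hδ) | ⟨i, j, hij, rfl⟩) | hδ) | hδ) | hδ)
    · cases hδ
      exact ⟨_, _, rfl, by simp, by simp [weight], by simp [weight_cx, weight]; omega⟩
    · cases hδ
      exact ⟨_, _, rfl, by simp, by simp [weight], by simp [weight_cx, weight]; omega⟩
    · have hi := psi_mono (show i ≤ n + 1 by omega)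
      have hj := psi_mono (show j ≤ n + 1 by omega)
      exact ⟨_, _, rfl, by simp, by simp [weight, hi, hj], by simp [weight_cx, weight]; omega⟩
    · cases hδ
      exact small _ _ (by simp) (by simp [weight_cx, weight]; nlinarith)
    · obtain ⟨α, hα, hδ⟩ := Set.mem_iUnion₂.1 hδ
      obtain ⟨X, l, rfl, hl, -, hw⟩ := hn.shape α hα
      obtain ⟨Y, as, bs, -, h, rfl⟩ := hδ
      obtain ⟨rfl, rfl⟩ := cx_inj h
      simp only [weight_cx, List.map_append, List.sum_append] at hw
      refine small _ _ ?_ ?_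
      · simp only [List.length_append, List.length_cons] at hl ⊢
        omega
      · simp only [weight_cx, List.map_cons, List.sum_cons, weight]
        nlinarith
    · obtain ⟨α, hα, hδ⟩ := Set.mem_iUnion₂.1 hδ
      obtain ⟨X, l, rfl, hl, ha, hw⟩ := hn.shape α hα
      obtain ⟨Y, as, x, y, bs, φl, φr, h, hr, rfl⟩ := hδ
      obtain ⟨rfl, rfl⟩ := cx_inj h
      -- Both rewritten arguments weigh at most `psi n`, so `φl` and `φr` together weigh at most
      -- `psi n * (1 + 2 * psi n)`.
      have hφ := ((rewriting_bound hP x y).2 _ hr).trans (Nat.mul_le_mul (ha x (by simp))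
        (Nat.add_le_add_left (Nat.mul_le_mul_left 2 (ha y (by simp))) 1))
      simp only [weight] at hφ
      simp only [weight_cx, List.map_append, List.map_cons, List.sum_append, List.sum_cons] at hw
      refine small _ _ ?_ ?_
      · simp only [List.length_append, List.length_cons] at hl ⊢
        omega
      · simp only [weight_cx, List.map_cons, List.sum_cons]
        nlinarith

lemma controlled_grammar_zero : Controlled 0 (grammar 0) := by
  rw [grammar]
  constructor
  · exact ((Covered.singleton _).union ((Covered.singleton _).union ((Covered.singleton _).union
      ((Covered.singleton _).union (Covered.singleton _))))).mono subset_rfl le_rfl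
  · rintro δ (hδ | hδ | hδ | hδ | hδ) <;> cases hδ
    · exact ⟨Comb.S, [], rfl, by simp, by simp, by simp [weight]⟩
    · exact ⟨Comb.K, [], rfl, by simp, by simp, by simp [weight]⟩
    all_goals exact ⟨_, _, rfl, by simp, by simp [weight], by simp [weight_cx, weight, psi]⟩

lemma controlled_grammar (n : ℕ) : Controlled n (grammar n) := by
  induction n using Nat.strong_induction_on with
  | _ n ih =>
    cases n with
    | zero => exact controlled_grammar_zero
    | succ n =>
      rw [grammar]
      -- The family is empty beyond `n`, and `chi` is monotone, so the single bound `chi n` serves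
      -- for every `k`.
      refine controlled_nextGrammar ⟨one_le_chi n, fun k => ?_, fun k δ hδ => ?_,
        fun k δ hδ => ?_⟩ (by simpa using ih n n.lt_succ_self)
      · split_ifs with h
        · exact (ih k (by omega)).covered.mono subset_rfl (chi_mono h)
        · exact Covered.empty _
      · split_ifs at hδ with h
        · obtain ⟨X, as, h1, -, h2, -⟩ := (ih k (by omega)).shape δ hδ
          exact ⟨X, as, h1, h2⟩
        · exact hδ.elim
      · split_ifs at hδ with h
        · obtain ⟨X, as, -, -, -, h1⟩ := (ih k (by omega)).shape δ hδ
          exact h1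
        · exact hδ.elim

end ReductionGrammar

theorem mainTheorem5 :
    Nat.Primrec ReductionGrammar.chi ∧
      ∀ n : ℕ, (ReductionGrammar.grammar n).Finite ∧
        (ReductionGrammar.grammar n).ncard ≤ ReductionGrammar.chi n :=
  ⟨Primrec.nat_iff.1 ReductionGrammar.primrec_chi, fun n =>
    ⟨(ReductionGrammar.controlled_grammar n).covered.finite,
      (ReductionGrammar.controlled_grammar n).covered.ncard_le⟩⟩
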